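/- Let $n\ge 4$ and let $X_n=\{1<2<\cdots<n\}$. Full transformations of $X_n$ are written on the right and composed from left to right, and $1_n$ denotes the identity transformation. A full transformation $\alpha$ of $X_n$ is order-decreasing if $x\alpha\le x$ for all $x\in X_n$. It is orientation-preserving (respectively, orientation-reversing) if there is at most one $i\in X_n$ with $(i+1)\alpha<i\alpha$ (respectively, $i\alpha<(i+1)\alpha$), where $(n+1)\alpha$ means $1\alpha$; it is oriented if it is orientation-preserving or orientation-reversing. Let $\mathcal{ORD}_n$ be the semigroup of all oriented and order-decreasing full transformations of $X_n$, and let $\mathcal{ORD}(n,n-1)=\{\alpha\in\mathcal{ORD}_n : |\mathrm{im}(\alpha)|\le n-1\}$. A maximal subsemigroup of a semigroup $U$ is a proper subsemigroup of $U$ such that no subsemigroup of $U$ lies strictly between it and $U$. Let $S$ be a subsemigroup of $\mathcal{ORD}_n$. Then $S$ is a maximal subsemigroup of $\mathcal{ORD}_n$ if and only if $S=\mathcal{ORD}(n,n-1)$ or there exists a maximal subsemigroup $T$ of $\mathcal{ORD}(n,n-1)$ such that $S=T\cup\{1_n\}$. -/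

import Mathlib

/-- The full transformations of the chain `X_n`, modelled by `Fin n` (so the least element `1` of
`X_n` is `0 : Fin n`). -/
def FullTransf (n : ℕ) : Type := Fin n → Fin n

namespace FullTransf

/-- Transformations act on the right: `x (α * β) = (x α) β`. The identity `1` is `1_n`. -/
instance instMonoid (n : ℕ) : Monoid (FullTransf n) where
  mul α β := fun x => β (α x)
  one := fun x => x
  mul_assoc _ _ _ := rfl
  one_mul _ := rfl
  mul_one _ := rfl

variable {n : ℕ}

theorem mul_app (α β : FullTransf n) (x : Fin n) : (α * β) x = β (α x) := rfl

/-- `x α ≤ x` for all `x`. -/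
def OrderDecreasing (α : FullTransf n) : Prop := ∀ x : Fin n, α x ≤ x

/-- The sequence `(1α, …, nα)` is cyclic: there is at most one `i` with `(i+1)α < iα`, where
`(n+1)α = 1α`. Here `finRotate n` is the cyclic successor `i ↦ i + 1`, sending the last element to
the first. -/
def OrientationPreserving (α : FullTransf n) : Prop :=
  ∀ i j : Fin n, α (finRotate n i) < α i → α (finRotate n j) < α j → i = j

/-- The sequence `(1α, …, nα)` is anti-cyclic: there is at most one `i` with `iα < (i+1)α`, where
`(n+1)α = 1α`. -/
def OrientationReversing (α : FullTransf n) : Prop :=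
  ∀ i j : Fin n, α i < α (finRotate n i) → α j < α (finRotate n j) → i = j

def Oriented (α : FullTransf n) : Prop := OrientationPreserving α ∨ OrientationReversing α

/-- The size of the image of `α`. -/
def rank (α : FullTransf n) : ℕ := (Finset.univ.image (fun x : Fin n => α x)).card

/-! Closure of the oriented order-decreasing transformations under products. -/

theorem OrderDecreasing.mul {α β : FullTransf n} (ha : OrderDecreasing α)
    (hb : OrderDecreasing β) : OrderDecreasing (α * β) :=
  fun x => (hb (α x)).trans (ha x)

theorem OrderDecreasing.map_zero {α : FullTransf (n + 1)} (h : OrderDecreasing α) : α 0 = 0 :=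
  le_antisymm (h 0) (Fin.zero_le _)

/-- If a sequence satisfies `P` at `i` and fails `P` at `j > i`, it stops satisfying `P` at some
step between. -/
theorem exists_step {P : Fin (n + 1) → Prop} {i j : Fin (n + 1)} (hij : i ≤ j) (hi : P i)
    (hj : ¬ P j) : ∃ k : Fin (n + 1), i ≤ k ∧ k < j ∧ P k ∧ ¬ P (finRotate (n + 1) k) := by
  by_contra! hc
  have key : ∀ m : ℕ, ∀ hm : m < n + 1, i.val ≤ m → m ≤ j.val → P ⟨m, hm⟩ := by
    intro m
    induction m with
    | zero =>
      intro hm h1 _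
      have : i = ⟨0, hm⟩ := Fin.ext (by simpa using h1)
      exact this ▸ hi
    | succ m ih =>
      intro hm h1 h2
      rcases Nat.lt_or_ge m i.val with h | h
      · have : i = ⟨m + 1, hm⟩ := Fin.ext (by simp; omega)
        exact this ▸ hi
      · have h3 := hc ⟨m, by omega⟩ h (by rw [Fin.lt_def]; simp; omega) (ih (by omega) h (by omega))
        rwa [finRotate_of_lt (by omega)] at h3
  exact hj (key j.val j.isLt hij le_rfl)

theorem exists_drop_end {P : Fin (n + 1) → Prop} {i : Fin (n + 1)} (hi : P i) (h0 : ¬ P 0) :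
    ∃ k : Fin (n + 1), i ≤ k ∧ P k ∧ ¬ P (finRotate (n + 1) k) := by
  by_cases hl : P (Fin.last n)
  · exact ⟨Fin.last n, Fin.le_last i, hl, by rwa [finRotate_last]⟩
  · obtain ⟨k, h1, -, h2, h3⟩ := exists_step (Fin.le_last i) hi hl
    exact ⟨k, h1, h2, h3⟩

theorem orientationPreserving_iff {α : FullTransf (n + 1)} (h0 : α 0 = 0) :
    OrientationPreserving α ↔ ∀ i j : Fin (n + 1), i ≤ j → α i ≤ α j ∨ ∀ k, j ≤ k → α k = 0 := by
  constructor
  · intro h i j hij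
    by_contra! hc
    obtain ⟨h1, k, hjk, hk⟩ := hc
    obtain ⟨a, -, ha2, ha3, ha4⟩ :=
      exists_step (P := fun x => α j < α x) hij h1 (lt_irrefl _)
    obtain ⟨b, hb1, hb2, hb3⟩ :=
      exists_drop_end (P := fun x => 0 < α x) (i := k) (Fin.pos_iff_ne_zero.2 hk) (by simp [h0])
    have hab := h a b ((not_lt.1 ha4).trans_lt ha3) ((not_lt.1 hb3).trans_lt hb2)
    subst hab
    exact absurd (ha2.trans_le (hjk.trans hb1)) (lt_irrefl _)
  · intro h
    have key : ∀ i j : Fin (n + 1), i < j → α (finRotate (n + 1) i) < α i →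
        α (finRotate (n + 1) j) < α j → False := by
      intro i j hij hi hj
      have hin : i.val < n := by have := j.isLt; have := Fin.lt_def.1 hij; omega
      have e : finRotate (n + 1) i = ⟨i.val + 1, by omega⟩ := finRotate_of_lt hin
      rw [e] at hi
      rcases h i ⟨i.val + 1, by omega⟩ (by rw [Fin.le_def]; simp) with h1 | h1
      · exact absurd hi (not_lt.2 h1)
      · rw [h1 j (by rw [Fin.le_def]; exact hij)] at hj
        exact absurd hj (Fin.not_lt_zero _)
    intro i j hi hj
    rcases lt_trichotomy i j with hl | hl | hl
    · exact (key i j hl hi hj).elim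
    · exact hl
    · exact (key j i hl hj hi).elim

theorem orientationReversing_iff {α : FullTransf (n + 1)} (h0 : α 0 = 0) :
    OrientationReversing α ↔ ∀ i j : Fin (n + 1), i ≤ j → α j ≤ α i ∨ ∀ k, k ≤ i → α k = 0 := by
  constructor
  · intro h i j hij
    by_contra! hc
    obtain ⟨h1, k, hki, hk⟩ := hc
    obtain ⟨a, ha1, -, ha3, ha4⟩ :=
      exists_step (P := fun x => α x ≤ α i) hij le_rfl (not_le.2 h1)
    obtain ⟨b, -, hb1, hb2, hb3⟩ :=
      exists_step (P := fun x => α x = 0) (i := 0) (j := k) (Fin.zero_le _) h0 hk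
    have hab := h a b (ha3.trans_lt (not_le.1 ha4))
      (by rw [hb2]; exact Fin.pos_iff_ne_zero.2 hb3)
    subst hab
    exact absurd (hb1.trans_le (hki.trans ha1)) (lt_irrefl _)
  · intro h
    have key : ∀ i j : Fin (n + 1), i < j → α i < α (finRotate (n + 1) i) →
        α j < α (finRotate (n + 1) j) → False := by
      intro i j hij hi hj
      have hin : i.val < n := by have := j.isLt; have := Fin.lt_def.1 hij; omega
      have e : finRotate (n + 1) i = ⟨i.val + 1, by omega⟩ := finRotate_of_lt hin
      rw [e] at hi
      rcases Nat.lt_or_ge j.val n with hjn | hjn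
      · have e' : finRotate (n + 1) j = ⟨j.val + 1, by omega⟩ := finRotate_of_lt hjn
        rw [e'] at hj
        rcases h j ⟨j.val + 1, by omega⟩ (by rw [Fin.le_def]; simp) with h1 | h1
        · exact absurd hj (not_lt.2 h1)
        · rw [h1 ⟨i.val + 1, by omega⟩ (by rw [Fin.le_def]; exact hij)] at hi
          exact absurd hi (Fin.not_lt_zero _)
      · have : j = Fin.last n := Fin.ext (by have := j.isLt; simp; omega)
        rw [this, finRotate_last, h0] at hj
        exact absurd hj (Fin.not_lt_zero _)
    intro i j hi hj
    rcases lt_trichotomy i j with hl | hl | hl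
    · exact (key i j hl hi hj).elim
    · exact hl
    · exact (key j i hl hj hi).elim

theorem Oriented.mul {α β : FullTransf n} (ha : OrderDecreasing α) (hb : OrderDecreasing β)
    (oa : Oriented α) (ob : Oriented β) : Oriented (α * β) := by
  cases n with
  | zero => exact Or.inl fun i => i.elim0
  | succ n =>
    have a0 := ha.map_zero
    have b0 := hb.map_zero
    have ab0 := (ha.mul hb).map_zero
    unfold Oriented at *
    rw [orientationPreserving_iff a0, orientationReversing_iff a0] at oa
    rw [orientationPreserving_iff b0, orientationReversing_iff b0] at ob
    rw [orientationPreserving_iff ab0, orientationReversing_iff ab0]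
    simp only [mul_app]
    rcases oa with oa | oa <;> rcases ob with ob | ob
    · left
      intro i j hij
      rcases oa i j hij with h | h
      · rcases ob _ _ h with h' | h'
        · exact Or.inl h'
        · right
          intro k hk
          rcases oa j k hk with h2 | h2
          · exact h' _ h2
          · rw [h2 k le_rfl, b0]
      · right
        intro k hk
        rw [h k hk, b0]
    · right
      intro i j hij
      by_cases hz : α j = 0
      · left
        rw [hz, b0]
        exact Fin.zero_le _
      · rcases oa i j hij with h | h
        · rcases ob _ _ h with h' | h'
          · exact Or.inl h'
          · right
            intro k hk
            rcases oa k i hk with h2 | h2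
            · exact h' _ h2
            · exact absurd (h2 j hij) hz
        · exact absurd (h j le_rfl) hz
    · right
      intro i j hij
      rcases oa i j hij with h | h
      · rcases ob _ _ h with h' | h'
        · exact Or.inl h'
        · right
          intro k hk
          rcases oa k i hk with h2 | h2
          · exact h' _ h2
          · rw [h2 k le_rfl, b0]
      · right
        intro k hk
        rw [h k hk, b0]
    · left
      intro i j hij
      by_cases hz : α i = 0
      · left
        rw [hz, b0]
        exact Fin.zero_le _
      · rcases oa i j hij with h | h
        · rcases ob _ _ h with h' | h'
          · exact Or.inl h'
          · right
            intro k hk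
            rcases oa j k hk with h2 | h2
            · exact h' _ h2
            · exact absurd (h2 i hij) hz
        · exact absurd (h i le_rfl) hz

theorem rank_mul_le (α β : FullTransf n) : rank (α * β) ≤ rank α := by
  have h : Finset.univ.image (fun x : Fin n => (α * β) x) =
      (Finset.univ.image (fun x : Fin n => α x)).image (fun y : Fin n => β y) := by
    rw [Finset.image_image]
    rfl
  unfold rank
  rw [h]
  exact Finset.card_image_le

end FullTransf

/-- The semigroup `ORD_n` of oriented and order-decreasing full transformations of `X_n`. -/
def ORD (n : ℕ) : Subsemigroup (FullTransf n) where
  carrier := {α | α.Oriented ∧ α.OrderDecreasing}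
  mul_mem' ha hb := ⟨FullTransf.Oriented.mul ha.2 hb.2 ha.1 hb.1, ha.2.mul hb.2⟩

/-- The semigroup `ORD(n,r)` of the elements of `ORD_n` whose image has at most `r` elements. -/
def ORDrank (n r : ℕ) : Subsemigroup (FullTransf n) where
  carrier := {α | α ∈ ORD n ∧ α.rank ≤ r}
  mul_mem' ha hb := ⟨(ORD n).mul_mem ha.1 hb.1, (FullTransf.rank_mul_le _ _).trans ha.2⟩

/-- `S` is a maximal subsemigroup of `U`: a proper subsemigroup of `U` such that no subsemigroup
of `U` lies strictly between `S` and `U`. -/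
def IsMaximalSubsemigroup {M : Type*} [Mul M] (S U : Subsemigroup M) : Prop :=
  S < U ∧ ∀ R : Subsemigroup M, S ≤ R → R ≤ U → R = S ∨ R = U

/-! ### Maximal subsemigroups when the identity splits off -/

section IdentitySplitsOff

variable {M : Type*} [Monoid M]

/-! An injective order-decreasing transformation fixes every point, so `1` is the only element of
`ORD n` of rank `n`, and removing it leaves the semigroup `ORDrank n (n - 1)`. The rest holds in any
monoid (`isMaximalSubsemigroup_iff_of_mem_iff_ne_one`): if `U` without `1` is a subsemigroup `I`,
then `T ↦ T ∪ {1}` and `S ↦ S ∩ I` are inverse order isomorphisms between the subsemigroups of `I`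
and those of `U` containing `1`, so they match maximal ones. A maximal `S` omitting `1` lies in `I`,
hence equals `I`. -/

/-- The subsemigroup obtained from `T` by adjoining the identity. -/
def Subsemigroup.adjoinOne (T : Subsemigroup M) : Subsemigroup M where
  carrier := (T : Set M) ∪ {1}
  mul_mem' := by
    rintro a b (ha | rfl) (hb | rfl)
    · exact Or.inl (T.mul_mem ha hb)
    · rw [mul_one]
      exact Or.inl ha
    · rw [one_mul]
      exact Or.inl hb
    · rw [one_mul]
      exact Or.inr rfl

theorem Subsemigroup.mem_adjoinOne {T : Subsemigroup M} {a : M} :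
    a ∈ T.adjoinOne ↔ a ∈ T ∨ a = 1 := Iff.rfl

/-- If `I` consists of the elements of `U` other than the identity, the maximal subsemigroups of
`U` are `I` itself and the maximal subsemigroups of `I` with the identity adjoined. -/
theorem isMaximalSubsemigroup_iff_of_mem_iff_ne_one {U I : Subsemigroup M} (hU : (1 : M) ∈ U)
    (hI : ∀ a, a ∈ I ↔ a ∈ U ∧ a ≠ 1) (S : Subsemigroup M) :
    IsMaximalSubsemigroup S U ↔
      (S = I ∨ ∃ T : Subsemigroup M, IsMaximalSubsemigroup T I ∧
        (S : Set M) = (T : Set M) ∪ {1}) := by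
  have hIU : I ≤ U := fun a ha => ((hI a).1 ha).1
  have h1I : (1 : M) ∉ I := fun h => ((hI 1).1 h).2 rfl
  constructor
  · rintro ⟨hlt, hmax⟩
    by_cases h1 : (1 : M) ∈ S
    · right
      refine ⟨S ⊓ I, ⟨⟨inf_le_right, fun h => hlt.not_ge fun a ha => ?_⟩, fun R hSR hRI => ?_⟩, ?_⟩
      · by_cases ha1 : a = 1
        · exact ha1 ▸ h1
        · exact (h ((hI a).2 ⟨ha, ha1⟩)).1
      -- Adjoining `1` places `R` between `S` and `U`, where maximality of `S` applies.
      · have hS : S ≤ R.adjoinOne := fun a ha => by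
          by_cases ha1 : a = 1
          · exact Or.inr ha1
          · exact Or.inl (hSR ⟨ha, (hI a).2 ⟨hlt.le ha, ha1⟩⟩)
        have hR : R.adjoinOne ≤ U := by
          rintro a (ha | rfl)
          · exact hIU (hRI ha)
          · exact hU
        rcases hmax _ hS hR with h | h
        · left
          exact le_antisymm (fun a ha => ⟨h ▸ Subsemigroup.mem_adjoinOne.2 (Or.inl ha), hRI ha⟩) hSR
        · right
          refine le_antisymm hRI fun a ha => ?_
          have haU : a ∈ R.adjoinOne := h ▸ hIU ha
          exact haU.resolve_right fun h => ((hI a).1 ha).2 h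
      · ext a
        constructor
        · intro ha
          by_cases ha1 : a = 1
          · exact Or.inr ha1
          · exact Or.inl ⟨ha, (hI a).2 ⟨hlt.le ha, ha1⟩⟩
        · rintro (ha | rfl)
          · exact ha.1
          · exact h1
    · left
      have hSI : S ≤ I := fun a ha => (hI a).2 ⟨hlt.le ha, fun h => h1 (h ▸ ha)⟩
      rcases hmax I hSI hIU with h | h
      · exact h.symm
      · exact absurd (h ▸ hU) h1I
  · rintro (rfl | ⟨T, ⟨hlt, hmax⟩, hST⟩)
    -- `I` misses only `1`, so whether `1 ∈ R` decides between `U` and `I`.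
    · refine ⟨⟨hIU, fun h => h1I (h hU)⟩, fun R hSR hRU => ?_⟩
      by_cases h1 : (1 : M) ∈ R
      · right
        refine le_antisymm hRU fun a ha => ?_
        by_cases ha1 : a = 1
        · exact ha1 ▸ h1
        · exact hSR ((hI a).2 ⟨ha, ha1⟩)
      · left
        exact le_antisymm (fun a ha => (hI a).2 ⟨hRU ha, fun h => h1 (h ▸ ha)⟩) hSR
    · obtain rfl : S = T.adjoinOne := SetLike.coe_injective hST
      refine ⟨⟨?_, fun h => hlt.not_ge fun a ha => ?_⟩, fun R hSR hRU => ?_⟩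
      · rintro a (ha | rfl)
        · exact hIU (hlt.le ha)
        · exact hU
      · exact (h (hIU ha)).resolve_right ((hI a).1 ha).2
      · have h1 : (1 : M) ∈ R := hSR (Or.inr rfl)
        -- Since `1 ∈ R`, `R` is determined by `R ⊓ I`, to which maximality of `T` applies.
        have hTR : T ≤ R ⊓ I := fun a ha => ⟨hSR (Or.inl ha), hlt.le ha⟩
        rcases hmax _ hTR inf_le_right with h | h
        · left
          refine le_antisymm (fun a ha => ?_) hSR
          by_cases ha1 : a = 1
          · exact Or.inr ha1
          · refine Or.inl ?_
            change a ∈ T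
            rw [← h]
            exact ⟨ha, (hI a).2 ⟨hRU ha, ha1⟩⟩
        · right
          refine le_antisymm hRU fun a ha => ?_
          by_cases ha1 : a = 1
          · exact ha1 ▸ h1
          · exact inf_eq_right.1 h ((hI a).2 ⟨ha, ha1⟩)

end IdentitySplitsOff

/-! ### Rank and the identity among order-decreasing transformations -/

namespace FullTransf

theorem one_app {n : ℕ} (x : Fin n) : (1 : FullTransf n) x = x := rfl

theorem rank_one (n : ℕ) : rank (1 : FullTransf n) = n := by
  simp [rank, one_app]

theorem orientationPreserving_one (n : ℕ) : OrientationPreserving (1 : FullTransf n) := by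
  cases n with
  | zero => exact fun i => i.elim0
  | succ n => exact (orientationPreserving_iff rfl).2 fun _ _ hij => Or.inl hij

/-- The only injective order-decreasing transformation is the identity. -/
theorem OrderDecreasing.eq_one_of_injective {n : ℕ} {α : FullTransf n} (h : OrderDecreasing α)
    (hinj : Function.Injective (fun x : Fin n => α x)) : α = 1 := by
  funext x
  induction x using WellFoundedLT.induction with
  | ind x ih =>
    by_contra hx
    have hlt : α x < x := lt_of_le_of_ne (h x) hx
    -- By induction `α` fixes the smaller point `α x`, so `α x` and `x` have the same image.
    exact hx (hinj (ih _ hlt))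

theorem OrderDecreasing.rank_lt_iff {n : ℕ} {α : FullTransf n} (h : OrderDecreasing α) :
    rank α < n ↔ α ≠ 1 := by
  constructor
  · rintro hr rfl
    exact hr.ne (rank_one n)
  · intro hα
    refine lt_of_le_of_ne (Finset.card_image_le.trans_eq (Finset.card_fin n)) fun hr => hα ?_
    have hinj : Set.InjOn (fun x : Fin n => α x) (Finset.univ : Finset (Fin n)) :=
      Finset.card_image_iff.1 (hr.trans (Finset.card_fin n).symm)
    exact h.eq_one_of_injective fun x y hxy =>
      hinj (Finset.mem_coe.2 (Finset.mem_univ x)) (Finset.mem_coe.2 (Finset.mem_univ y)) hxy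

end FullTransf

theorem one_mem_ORD (n : ℕ) : (1 : FullTransf n) ∈ ORD n :=
  ⟨Or.inl (FullTransf.orientationPreserving_one n), fun _ => le_rfl⟩

theorem mem_ORDrank_pred_iff {n : ℕ} (hn : 0 < n) (α : FullTransf n) :
    α ∈ ORDrank n (n - 1) ↔ α ∈ ORD n ∧ α ≠ 1 :=
  and_congr_right fun h => (Nat.le_sub_one_iff_lt hn).trans h.2.rank_lt_iff

theorem theorem4p5 (n : ℕ) (hn : 4 ≤ n) (S : Subsemigroup (FullTransf n)) (hS : S ≤ ORD n) :
    IsMaximalSubsemigroup S (ORD n) ↔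
      (S = ORDrank n (n - 1) ∨
        ∃ T : Subsemigroup (FullTransf n), IsMaximalSubsemigroup T (ORDrank n (n - 1)) ∧
          (S : Set (FullTransf n)) = (T : Set (FullTransf n)) ∪ {1}) :=
  isMaximalSubsemigroup_iff_of_mem_iff_ne_one (one_mem_ORD n)
    (mem_ORDrank_pred_iff (by omega)) S
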